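/- Let $\mathcal X$ be a measurable space (e.g. $[0,1]^d$), let $(X,Y)\sim P$ take values in $\mathcal X\times\{-1,1\}$, with $P_X$ the law of $X$, and let $(x_1,y_1),(x_2,y_2),\dots$ be independent copies of $(X,Y)$. Let $\mu$ be a measure on $\mathcal X$ and $K>0$ with $P_X\le K\mu$ (for example $\mu=P_X$ and $K=1$, or $\mu$ the Lebesgue measure on $[0,1]^d$ if $P_X$ has a density bounded by $K$). For $\delta>0$ and a class $\mathcal F$ of real functions on $\mathcal X$, the bracketing entropy $H_B(\delta,\mathcal F,\|\cdot\|_2)$ is the logarithm of the smallest number $N$ of pairs $(f_i^L,f_i^U)$ of measurable functions with $\big(\int |f_i^U-f_i^L|^2\,d\mu\big)^{1/2}\le\delta$ such that every $f\in\mathcal F$ satisfies $f_i^L\le f\le f_i^U$ pointwise for some $i$ (and $+\infty$ if there is no finite $N$). For a loss $\phi:\mathbb R\to\mathbb R$ put $\mathcal E_\phi(f)=\mathrm E[\phi(Yf(X))]$ and $\mathcal E_\phi(f,g)=\mathcal E_\phi(f)-\mathcal E_\phi(g)$. Let $\mathcal F_n$, $n\ge1$, be classes of functions contained in a class $\mathcal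 F_\infty$ of measurable functions $\mathcal X\to\mathbb R$ (e.g. all of them), and let $f^*_\phi\in\mathcal F_\infty$ have finite $\phi$-risk and minimize $\mathcal E_\phi$ over all $f\in\mathcal F_\infty$ of finite $\phi$-risk. Assume that there are constants $C_1,C_2,C_3>0$ and $\nu\in(0,1]$ and sequences $a_n>0$, $F_n$, $\delta_n>0$ such that for all $n\ge1$: (A1) $|\phi(z_1)-\phi(z_2)|\le C_1|z_1-z_2|$ for all $z_1,z_2\in\mathbb R$; (A2) $a_n=O(n^{-a_0})$ as $n\to\infty$ for some $a_0>0$, and $\mathcal E_\phi(f_n,f^*_\phi)\le a_n$ for some $f_n\in\mathcal F_n$; (A3) $\sup_{f\in\mathcal F_n}\sup_{x}|f(x)|\le F_n$, where $F_n$ is bounded below by a positive constant for all sufficiently large $n$; (A4) $\mathrm E\big[\{\phi(Yf(X))-\phi(Yf^*_\phi(X))\}^2\big]\le C_2F_n^{2-\nu}\,\mathcal E_\phi(f,f^*_\phi)^{\nu}$ for every $f\in\mathcal F_n$; (A5) $H_B(\delta_n,\mathcal F_n,\|\cdot\|_2)\le C_3\,n\,(\delta_n/F_n)^{2-\nu}$.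 Let $\widehat f_{\phi,n}$ be an empirical $\phi$-risk minimizer over $\mathcal F_n$, that is, almost surely $\widehat f_{\phi,n}\in\mathcal F_n$ minimizes $\frac1n\sum_{i=1}^n\phi(y_if(x_i))$ over $f\in\mathcal F_n$. Theorem. There are positive constants $c_0,C,C'$ depending only on $C_1,C_2,C_3,\nu,K$ such that for every sequence $\epsilon_n$ with $\epsilon_n^2\ge c_0\max\{a_n,\delta_n\}$ for all sufficiently large $n$ (in particular for $\epsilon_n^2=c\max\{a_n,\delta_n\}$ with any fixed $c\ge c_0$, so that $\epsilon_n^2\asymp\max\{a_n,\delta_n\}$), $$\Pr\big(\mathcal E_\phi(\widehat f_{\phi,n},f^*_\phi)\ge\epsilon_n^2\big)\le C'\exp\big(-C\,n\,(\epsilon_n^2/F_n)^{2-\nu}\big)$$ for all sufficiently large $n$, where $\Pr$ is read as outer probability if the event is not measurable. -/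

import Mathlib

open MeasureTheory ProbabilityTheory Filter
open scoped ENNReal

noncomputable section

/-- The population `φ`-risk `E[φ(Y f(X))]`, where `(X, Y)` has law `P`. -/
def phiRisk {𝒳 : Type*} [MeasurableSpace 𝒳] (φ : ℝ → ℝ) (P : Measure (𝒳 × ℝ))
    (f : 𝒳 → ℝ) : ℝ :=
  ∫ z, φ (z.2 * f z.1) ∂P

/-- The excess `φ`-risk of `f` over `g`, `E[φ(Y f(X))] - E[φ(Y g(X))]`. -/
def excessPhiRisk {𝒳 : Type*} [MeasurableSpace 𝒳] (φ : ℝ → ℝ) (P : Measure (𝒳 × ℝ))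
    (f g : 𝒳 → ℝ) : ℝ :=
  phiRisk φ P f - phiRisk φ P g

/-- `fstar` minimizes the `φ`-risk over the class `G`. Members of `G` whose `φ`-risk is not
finite do not compete (their Bochner integral would be a meaningless `0`). -/
structure IsPhiRiskMinimizer {𝒳 : Type*} [MeasurableSpace 𝒳] (φ : ℝ → ℝ)
    (P : Measure (𝒳 × ℝ)) (G : Set (𝒳 → ℝ)) (fstar : 𝒳 → ℝ) : Prop where
  mem : fstar ∈ G
  integrable : Integrable (fun z : 𝒳 × ℝ => φ (z.2 * fstar z.1)) P
  le : ∀ f ∈ G, Integrable (fun z : 𝒳 × ℝ => φ (z.2 * f z.1)) P →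
    phiRisk φ P fstar ≤ phiRisk φ P f

/-- The empirical `φ`-risk `n⁻¹ ∑ φ(yᵢ f(xᵢ))` of the first `n` points of a data sequence. -/
def empiricalPhiRisk {𝒳 : Type*} (φ : ℝ → ℝ) (n : ℕ) (z : ℕ → 𝒳 × ℝ) (f : 𝒳 → ℝ) : ℝ :=
  (∑ i ∈ Finset.range n, φ ((z i).2 * f (z i).1)) / (n : ℝ)

/-- `fhat` minimizes the empirical `φ`-risk of the first `n` data points over the class `𝓕`. -/
def IsEmpiricalPhiRiskMinimizer {𝒳 : Type*} (φ : ℝ → ℝ) (n : ℕ) (z : ℕ → 𝒳 × ℝ)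
    (𝓕 : Set (𝒳 → ℝ)) (fhat : 𝒳 → ℝ) : Prop :=
  fhat ∈ 𝓕 ∧ ∀ f ∈ 𝓕, empiricalPhiRisk φ n z fhat ≤ empiricalPhiRisk φ n z f

/-- `𝓕` has a `δ`-bracketing set of `N` pairs of measurable functions in the norm of `L²(μ)`. -/
def HasBracketing {𝒳 : Type*} [MeasurableSpace 𝒳] (μ : Measure 𝒳) (δ : ℝ)
    (𝓕 : Set (𝒳 → ℝ)) (N : ℕ) : Prop :=
  ∃ l u : Fin N → 𝒳 → ℝ,
    (∀ i, Measurable (l i) ∧ Measurable (u i)) ∧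
    (∀ i, eLpNorm (fun x => u i x - l i x) 2 μ ≤ ENNReal.ofReal δ) ∧
    ∀ f ∈ 𝓕, ∃ i, ∀ x, l i x ≤ f x ∧ f x ≤ u i x

/-- The `δ`-bracketing number of `𝓕` in `L²(μ)` (`⊤` if there is no finite bracketing set). -/
def bracketingNumber {𝒳 : Type*} [MeasurableSpace 𝒳] (μ : Measure 𝒳) (δ : ℝ)
    (𝓕 : Set (𝒳 → ℝ)) : ℕ∞ :=
  ⨅ (N : ℕ) (_ : HasBracketing μ δ 𝓕 N), (N : ℕ∞)

/-- The `δ`-bracketing entropy `H_B(δ, 𝓕, ‖·‖₂)`, the logarithm of the bracketing number. -/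
def bracketingEntropy {𝒳 : Type*} [MeasurableSpace 𝒳] (μ : Measure 𝒳) (δ : ℝ)
    (𝓕 : Set (𝒳 → ℝ)) : EReal :=
  ENNReal.log ((bracketingNumber μ δ 𝓕 : ℕ∞) : ℝ≥0∞)

end

/-!
The proof is a one-step bracketing argument; neither chaining nor peeling is needed.

Fix `n` and write `b = ε n ^ 2`. The class `𝓕 n` is covered by at most
`exp (C₃ n (δ n / F n) ^ (2 - ν))` brackets. In each bracket that meets
`{f | b ≤ excessPhiRisk φ P f fstar}`, pick a member `g` of this set, with excess risk `e ≥ b`, and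
let `w` be the width of the bracket truncated at `2 F n`. As `φ` is Lipschitz, for every `f` of the
bracket the difference `φ(Y f) - φ(Y f₀)`, where `f₀` is the approximant with excess risk at most
`a n`, is bounded below by `h = φ(Y g) - φ(Y f₀) - C₁ w` (`bracketLoss`). So if the empirical
minimizer lies in the bracket and has excess risk at least `b`, then `∑ h(Zᵢ) ≤ 0`.

This event is improbable. For `b ≥ c₀ max (a n) (δ n)` the mean of `h` is at least `e / 2`
(`le_integral_bracketLoss`); `h` is bounded by a multiple of `F n`; and its second moment is at most
a multiple of `F n ^ (2 - ν) * e ^ ν` (`integral_sq_bracketLoss_le`), by the variance condition for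
`g` and `f₀` and by `min_sq_le_rpow` for `w`. A Chernoff bound of Bernstein type
(`measureReal_sum_le_zero_le`) then gives the probability
`exp (-(θ / 4) n (e / F n) ^ (2 - ν)) ≤ exp (-(θ / 4) n (b / F n) ^ (2 - ν))`: members of larger
excess risk only help, which is why no peeling is needed (`exists_event_of_bracket`). In the union
bound over the brackets the entropy uses up at most half of the exponent once `c₀` is large.
-/

/-! ### Bracketing numbers -/

lemma exists_hasBracketing_card_le {𝒳 : Type*} [MeasurableSpace 𝒳] {μ : Measure 𝒳} {δ x : ℝ}
    {𝓕 : Set (𝒳 → ℝ)} (h : bracketingEntropy μ δ 𝓕 ≤ (x : EReal)) :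
    ∃ N, HasBracketing μ δ 𝓕 N ∧ (N : ℝ) ≤ Real.exp x := by
  have h1 : ((bracketingNumber μ δ 𝓕 : ℕ∞) : ℝ≥0∞) ≤ ENNReal.ofReal (Real.exp x) := by
    rw [← EReal.exp_coe, ← ENNReal.exp_log ((bracketingNumber μ δ 𝓕 : ℕ∞) : ℝ≥0∞)]
    exact EReal.exp_monotone h
  have hne : bracketingNumber μ δ 𝓕 ≠ ⊤ := by
    intro h2
    rw [h2] at h1
    simp at h1
  have hex : ∃ N, HasBracketing μ δ 𝓕 N := by
    by_contra hcon
    push Not at hcon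
    exact hne (by simp [bracketingNumber, hcon])
  have hmin : ∃ N, HasBracketing μ δ 𝓕 N ∧ (N : ℕ∞) ≤ bracketingNumber μ δ 𝓕 := by
    classical
    refine ⟨Nat.find hex, Nat.find_spec hex, ?_⟩
    refine le_iInf fun M => le_iInf fun hM => ?_
    exact_mod_cast Nat.find_min' hex hM
  obtain ⟨N, hN, hle⟩ := hmin
  refine ⟨N, hN, ?_⟩
  have h3 : ((N : ℕ∞) : ℝ≥0∞) ≤ ENNReal.ofReal (Real.exp x) :=
    (ENat.toENNReal_le.2 hle).trans h1
  have h4 : ENNReal.ofReal (N : ℝ) ≤ ENNReal.ofReal (Real.exp x) := by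
    simpa using h3
  exact (ENNReal.ofReal_le_ofReal_iff (Real.exp_pos x).le).1 h4

/-- Brackets that are `δ`-narrow in `L²(μ)` are narrow in `L²` of the law of `X`, because `K μ`
dominates that law. -/
lemma lintegral_sq_bracket_le {𝒳 : Type*} [MeasurableSpace 𝒳] {P : Measure (𝒳 × ℝ)}
    {μ : Measure 𝒳} {K δ : ℝ} (hK : 0 < K) (hδ : 0 ≤ δ)
    (hdom : P.map Prod.fst ≤ ENNReal.ofReal K • μ) {v : 𝒳 → ℝ} (hv : Measurable v)
    (hvδ : eLpNorm v 2 μ ≤ ENNReal.ofReal δ) :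
    ∫⁻ z, ENNReal.ofReal (v z.1 ^ 2) ∂P ≤ ENNReal.ofReal (K * δ ^ 2) := by
  have h1 : ∫⁻ x, ENNReal.ofReal (v x ^ 2) ∂μ = eLpNorm v 2 μ ^ 2 := by
    have h := eLpNorm_nnreal_pow_eq_lintegral (f := v) (μ := μ) (p := 2) two_ne_zero
    have e : ∀ x, ‖v x‖ₑ ^ (2 : ℝ) = ENNReal.ofReal (v x ^ 2) := fun x => by
      rw [← sq_abs, ENNReal.ofReal_pow (abs_nonneg _), ← Real.norm_eq_abs,
        ofReal_norm]
      exact_mod_cast ENNReal.rpow_natCast _ 2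
    have h2 : ((2 : NNReal) : ℝ) = 2 := rfl
    rw [h2] at h
    simp_rw [e] at h
    rw [← h]
    exact_mod_cast ENNReal.rpow_natCast _ 2
  have hm : Measurable fun x => ENNReal.ofReal (v x ^ 2) := by fun_prop
  calc ∫⁻ z, ENNReal.ofReal (v z.1 ^ 2) ∂P
      = ∫⁻ x, ENNReal.ofReal (v x ^ 2) ∂(P.map Prod.fst) :=
        (lintegral_map hm measurable_fst).symm
    _ ≤ ∫⁻ x, ENNReal.ofReal (v x ^ 2) ∂(ENNReal.ofReal K • μ) := lintegral_mono' hdom le_rfl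
    _ = ENNReal.ofReal K * eLpNorm v 2 μ ^ 2 := by rw [lintegral_smul_measure, h1, smul_eq_mul]
    _ ≤ ENNReal.ofReal K * ENNReal.ofReal δ ^ 2 := by gcongr
    _ = ENNReal.ofReal (K * δ ^ 2) := by
        rw [ENNReal.ofReal_mul hK.le, ENNReal.ofReal_pow hδ]

/-! ### An exponential inequality for bounded variables -/

lemma integrable_and_integral_le_of_lintegral_le {α : Type*} [MeasurableSpace α] {P : Measure α}
    {f : α → ℝ} {B : ℝ} (hf : Measurable f) (h0 : ∀ z, 0 ≤ f z) (hB : 0 ≤ B)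
    (h : ∫⁻ z, ENNReal.ofReal (f z) ∂P ≤ ENNReal.ofReal B) :
    Integrable f P ∧ ∫ z, f z ∂P ≤ B := by
  refine ⟨⟨hf.aestronglyMeasurable, ?_⟩, ?_⟩
  · rw [hasFiniteIntegral_iff_ofReal (ae_of_all _ h0)]
    exact h.trans_lt ENNReal.ofReal_lt_top
  · rw [integral_eq_lintegral_of_nonneg_ae (ae_of_all _ h0) hf.aestronglyMeasurable]
    exact ENNReal.toReal_le_of_le_ofReal hB h

/-- A Bernstein-type Chernoff bound that needs no centring: since `exp x ≤ 1 + x + x ^ 2` for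
`|x| ≤ 1`, the Laplace transform of `h` at `-t` is at most `exp (-t E h + t ^ 2 E h ^ 2)`. -/
lemma measureReal_sum_le_zero_le {α Ω : Type*} [MeasurableSpace α] [MeasurableSpace Ω]
    {P : Measure α} [IsProbabilityMeasure P] {Q : Measure Ω} [IsProbabilityMeasure Q]
    {Z : ℕ → Ω → α} (hZ : ∀ i, Measurable (Z i)) (hind : iIndepFun Z Q)
    (hlaw : ∀ i, Q.map (Z i) = P) {h : α → ℝ} (hh : Measurable h) {M t : ℝ}
    (hM : ∀ᵐ z ∂P, |h z| ≤ M) (ht : 0 ≤ t) (htM : t * M ≤ 1) (n : ℕ) :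
    Q.real {ω | ∑ i ∈ Finset.range n, h (Z i ω) ≤ 0} ≤
      Real.exp (n * (-t * ∫ z, h z ∂P + t ^ 2 * ∫ z, h z ^ 2 ∂P)) := by
  have hint : Integrable h P := Integrable.of_bound hh.aestronglyMeasurable M hM
  have hint2 : Integrable (fun z => h z ^ 2) P := by
    refine Integrable.of_bound (by fun_prop) (M ^ 2) ?_
    filter_upwards [hM] with z hz
    rw [Real.norm_eq_abs, abs_pow]
    gcongr
  have hintexp : Integrable (fun z => Real.exp (-t * h z)) P :=
    integrable_exp_mul_of_mem_Icc (a := -M) (b := M) hh.aemeasurable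
      (by filter_upwards [hM] with z hz using abs_le.1 hz)
  have hmgfP : ∫ z, Real.exp (-t * h z) ∂P ≤
      Real.exp (-t * ∫ z, h z ∂P + t ^ 2 * ∫ z, h z ^ 2 ∂P) := by
    have hI1 : Integrable (fun z => 1 + -t * h z) P := (integrable_const _).add (hint.const_mul _)
    calc ∫ z, Real.exp (-t * h z) ∂P
        ≤ ∫ z, ((1 + -t * h z) + t ^ 2 * h z ^ 2) ∂P := by
          refine integral_mono_ae hintexp (hI1.add (hint2.const_mul _)) ?_
          filter_upwards [hM] with z hz
          have h1 : |-t * h z| ≤ 1 := by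
            rw [abs_mul, abs_neg, abs_of_nonneg ht]
            exact (mul_le_mul_of_nonneg_left hz ht).trans htM
          have h2 := (abs_le.1 (Real.abs_exp_sub_one_sub_id_le h1)).2
          nlinarith
      _ = (-t * ∫ z, h z ∂P + t ^ 2 * ∫ z, h z ^ 2 ∂P) + 1 := by
          rw [integral_add hI1 (hint2.const_mul _),
            integral_add (integrable_const _) (hint.const_mul _), integral_const_mul,
            integral_const_mul]
          simp
          ring
      _ ≤ _ := Real.add_one_le_exp _
  have hmgf : ∀ i, mgf (h ∘ Z i) Q (-t) = ∫ z, Real.exp (-t * h z) ∂P := fun i => by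
    rw [← hlaw i, integral_map (hZ i).aemeasurable
      (by rw [hlaw i]; exact hintexp.aestronglyMeasurable)]
    rfl
  have hindh : iIndepFun (fun i => h ∘ Z i) Q := hind.comp (fun _ => h) (fun _ => hh)
  have hmeas : ∀ i, Measurable (h ∘ Z i) := fun i => hh.comp (hZ i)
  have hae : ∀ᵐ ω ∂Q, ∀ i, |h (Z i ω)| ≤ M := by
    rw [ae_all_iff]
    intro i
    have := hM
    rw [← hlaw i] at this
    exact ae_of_ae_map (hZ i).aemeasurable this
  have hsumexp : Integrable (fun ω => Real.exp (-t * (∑ i ∈ Finset.range n, h ∘ Z i) ω)) Q := by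
    refine integrable_exp_mul_of_mem_Icc (a := -(n * M)) (b := n * M)
      (by fun_prop) ?_
    filter_upwards [hae] with ω hω
    rw [Finset.sum_apply]
    have h1 : |∑ i ∈ Finset.range n, (h ∘ Z i) ω| ≤ n * M := by
      refine (Finset.abs_sum_le_sum_abs _ _).trans ?_
      refine (Finset.sum_le_sum fun i _ => hω i).trans ?_
      simp
    exact abs_le.1 h1
  have key := measure_le_le_exp_mul_mgf (μ := Q) (X := ∑ i ∈ Finset.range n, h ∘ Z i) (t := -t) 0
    (by linarith) hsumexp
  rw [hindh.mgf_sum hmeas] at key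
  simp only [hmgf, Finset.prod_const, Finset.card_range, mul_zero, Real.exp_zero, one_mul,
    Finset.sum_apply, Function.comp_apply] at key
  refine key.trans ?_
  rw [Real.exp_nat_mul]
  gcongr

/-! ### Excess loss over a bracket -/

/-- A lower bound for the loss differences `φ(Y f(X)) - φ(Y f₀(X))` over all `f` in a bracket:
`g` is a member of the bracket and `w` its width. -/
def bracketLoss {𝒳 : Type*} (φ : ℝ → ℝ) (C₁ : ℝ) (f₀ g w : 𝒳 → ℝ) (z : 𝒳 × ℝ) : ℝ :=
  φ (z.2 * g z.1) - φ (z.2 * f₀ z.1) - C₁ * w z.1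

section Loss

variable {𝒳 : Type*} {φ : ℝ → ℝ} {C₁ : ℝ}

lemma continuous_of_abs_sub_le (hφ : ∀ z₁ z₂ : ℝ, |φ z₁ - φ z₂| ≤ C₁ * |z₁ - z₂|) :
    Continuous φ :=
  (LipschitzWith.of_dist_le_mul (K := C₁.toNNReal) fun x y => by
    rw [Real.dist_eq, Real.dist_eq]
    refine (hφ x y).trans ?_
    gcongr
    exact Real.le_coe_toNNReal C₁).continuous

lemma abs_loss_sub_le (hφ : ∀ z₁ z₂ : ℝ, |φ z₁ - φ z₂| ≤ C₁ * |z₁ - z₂|) {y : ℝ}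
    (hy : y = 1 ∨ y = -1) (s t : ℝ) : |φ (y * s) - φ (y * t)| ≤ C₁ * |s - t| := by
  have h := hφ (y * s) (y * t)
  have hy1 : |y| = 1 := by rcases hy with rfl | rfl <;> simp
  rwa [← mul_sub, abs_mul, hy1, one_mul] at h

/-- The truncation at `2 F` of the width of a bracket costs nothing for functions bounded
by `F`. -/
lemma abs_sub_le_min_width {f g l u F : ℝ} (hf : |f| ≤ F) (hg : |g| ≤ F) (hf' : l ≤ f ∧ f ≤ u)
    (hg' : l ≤ g ∧ g ≤ u) : |f - g| ≤ min (u - l) (2 * F) := by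
  rw [abs_le] at hf hg
  refine le_min (abs_le.2 ⟨?_, ?_⟩) (abs_le.2 ⟨?_, ?_⟩) <;> linarith

lemma sum_bracketLoss_nonpos (hφ : ∀ z₁ z₂ : ℝ, |φ z₁ - φ z₂| ≤ C₁ * |z₁ - z₂|) (hC₁ : 0 ≤ C₁)
    {f f₀ g w : 𝒳 → ℝ} (hw : ∀ x, |f x - g x| ≤ w x) {n : ℕ} (hn : 1 ≤ n) {z : ℕ → 𝒳 × ℝ}
    (hz : ∀ i, (z i).2 = 1 ∨ (z i).2 = -1)
    (hemp : empiricalPhiRisk φ n z f ≤ empiricalPhiRisk φ n z f₀) :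
    ∑ i ∈ Finset.range n, bracketLoss φ C₁ f₀ g w (z i) ≤ 0 := by
  have hn0 : (0 : ℝ) < n := by exact_mod_cast hn
  have h1 := (div_le_div_iff_of_pos_right hn0).1 hemp
  calc ∑ i ∈ Finset.range n, bracketLoss φ C₁ f₀ g w (z i)
      ≤ ∑ i ∈ Finset.range n, (φ ((z i).2 * f (z i).1) - φ ((z i).2 * f₀ (z i).1)) := by
        refine Finset.sum_le_sum fun i _ => ?_
        have h2 := abs_loss_sub_le hφ (hz i) (f (z i).1) (g (z i).1)
        have h3 := mul_le_mul_of_nonneg_left (hw (z i).1) hC₁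
        have h4 := (abs_le.1 h2).1
        unfold bracketLoss
        linarith
    _ ≤ 0 := by
        rw [Finset.sum_sub_distrib]
        linarith

lemma abs_bracketLoss_le (hφ : ∀ z₁ z₂ : ℝ, |φ z₁ - φ z₂| ≤ C₁ * |z₁ - z₂|) (hC₁ : 0 ≤ C₁)
    {f₀ g w : 𝒳 → ℝ} {F : ℝ} (h₀ : ∀ x, |f₀ x| ≤ F) (hg : ∀ x, |g x| ≤ F) (hw0 : ∀ x, 0 ≤ w x)
    (hwF : ∀ x, w x ≤ 2 * F) {z : 𝒳 × ℝ} (hz : z.2 = 1 ∨ z.2 = -1) :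
    |bracketLoss φ C₁ f₀ g w z| ≤ 4 * C₁ * F := by
  have h1 := abs_loss_sub_le hφ hz (g z.1) (f₀ z.1)
  have h2 : |g z.1 - f₀ z.1| ≤ 2 * F := by
    have := abs_sub (g z.1) (f₀ z.1)
    linarith [h₀ z.1, hg z.1]
  have h3 := mul_le_mul_of_nonneg_left h2 hC₁
  have h4 := mul_le_mul_of_nonneg_left (hwF z.1) hC₁
  have h5 := mul_nonneg hC₁ (hw0 z.1)
  have h6 := abs_le.1 h1
  unfold bracketLoss
  exact abs_le.2 ⟨by linarith, by linarith⟩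

variable [MeasurableSpace 𝒳] {P : Measure (𝒳 × ℝ)}

lemma measurable_loss (hφ : ∀ z₁ z₂ : ℝ, |φ z₁ - φ z₂| ≤ C₁ * |z₁ - z₂|) {f : 𝒳 → ℝ}
    (hf : Measurable f) : Measurable fun z : 𝒳 × ℝ => φ (z.2 * f z.1) :=
  (continuous_of_abs_sub_le hφ).measurable.comp (by fun_prop)

lemma integrable_loss [IsProbabilityMeasure P] (hlab : ∀ᵐ z ∂P, z.2 = 1 ∨ z.2 = -1)
    (hC₁ : 0 ≤ C₁) (hφ : ∀ z₁ z₂ : ℝ, |φ z₁ - φ z₂| ≤ C₁ * |z₁ - z₂|) {f : 𝒳 → ℝ} {F : ℝ}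
    (hf : Measurable f) (hF : ∀ x, |f x| ≤ F) :
    Integrable (fun z : 𝒳 × ℝ => φ (z.2 * f z.1)) P := by
  refine Integrable.of_bound (measurable_loss hφ hf).aestronglyMeasurable (|φ 0| + C₁ * F) ?_
  filter_upwards [hlab] with z hz
  have h := abs_loss_sub_le hφ hz (f z.1) 0
  rw [mul_zero, sub_zero] at h
  have h1 : C₁ * |f z.1| ≤ C₁ * F := mul_le_mul_of_nonneg_left (hF _) hC₁
  have h2 := abs_sub_abs_le_abs_sub (φ (z.2 * f z.1)) (φ 0)
  rw [Real.norm_eq_abs]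
  linarith

lemma excessPhiRisk_nonneg [IsProbabilityMeasure P] (hlab : ∀ᵐ z ∂P, z.2 = 1 ∨ z.2 = -1)
    (hC₁ : 0 ≤ C₁) (hφ : ∀ z₁ z₂ : ℝ, |φ z₁ - φ z₂| ≤ C₁ * |z₁ - z₂|) {G : Set (𝒳 → ℝ)}
    {fstar f : 𝒳 → ℝ} (hstar : IsPhiRiskMinimizer φ P G fstar) (hfG : f ∈ G)
    (hf : Measurable f) {F : ℝ} (hF : ∀ x, |f x| ≤ F) : 0 ≤ excessPhiRisk φ P f fstar :=
  sub_nonneg.2 (hstar.le f hfG (integrable_loss hlab hC₁ hφ hf hF))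

lemma measurable_bracketLoss (hφ : ∀ z₁ z₂ : ℝ, |φ z₁ - φ z₂| ≤ C₁ * |z₁ - z₂|)
    {f₀ g w : 𝒳 → ℝ} (h₀ : Measurable f₀) (hg : Measurable g) (hw : Measurable w) :
    Measurable (bracketLoss φ C₁ f₀ g w) :=
  ((measurable_loss hφ hg).sub (measurable_loss hφ h₀)).sub (by fun_prop)

lemma le_integral_bracketLoss [IsProbabilityMeasure P] {fstar f₀ g w : 𝒳 → ℝ} {K δ : ℝ}
    (hC₁ : 0 ≤ C₁) (hK : 0 ≤ K) (hδ : 0 < δ)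
    (hg : Integrable (fun z : 𝒳 × ℝ => φ (z.2 * g z.1)) P)
    (h₀ : Integrable (fun z : 𝒳 × ℝ => φ (z.2 * f₀ z.1)) P)
    (hw : Measurable w) (hw0 : ∀ x, 0 ≤ w x) {B : ℝ} (hwB : ∀ x, w x ≤ B)
    (hwδ : ∫⁻ z, ENNReal.ofReal (w z.1 ^ 2) ∂P ≤ ENNReal.ofReal (K * δ ^ 2)) :
    excessPhiRisk φ P g fstar - excessPhiRisk φ P f₀ fstar - C₁ * (K + 1) * δ ≤
      ∫ z, bracketLoss φ C₁ f₀ g w z ∂P := by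
  have hwi : Integrable (fun z : 𝒳 × ℝ => w z.1) P :=
    Integrable.of_bound (hw.comp measurable_fst).aestronglyMeasurable B
      (ae_of_all _ fun z => by rw [Real.norm_eq_abs, abs_of_nonneg (hw0 _)]; exact hwB _)
  obtain ⟨hw2, hw2le⟩ := integrable_and_integral_le_of_lintegral_le (P := P)
    (f := fun z : 𝒳 × ℝ => w z.1 ^ 2) (by fun_prop) (fun z => sq_nonneg _) (by positivity) hwδ
  have hmean : ∫ z, w z.1 ∂P ≤ (K + 1) * δ := by
    -- the inequality `w ≤ w ^ 2 / (2 δ) + δ / 2` replaces the one of Cauchy and Schwarz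
    have h1 : ∫ z, w z.1 ∂P ≤ ∫ z, ((2 * δ)⁻¹ * w z.1 ^ 2 + δ / 2) ∂P := by
      refine integral_mono hwi ((hw2.const_mul _).add (integrable_const _)) fun z => ?_
      have h2 : (2 * δ)⁻¹ * w z.1 ^ 2 + δ / 2 - w z.1 = (2 * δ)⁻¹ * (w z.1 - δ) ^ 2 := by
        field_simp
        ring
      have h3 : 0 ≤ (2 * δ)⁻¹ * (w z.1 - δ) ^ 2 := by positivity
      simp only
      linarith
    rw [integral_add (hw2.const_mul _) (integrable_const _), integral_const_mul] at h1
    simp only [integral_const, probReal_univ, smul_eq_mul, one_mul] at h1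
    have h4 : (2 * δ)⁻¹ * ∫ z, w z.1 ^ 2 ∂P ≤ (2 * δ)⁻¹ * (K * δ ^ 2) := by gcongr
    have h5 : (2 * δ)⁻¹ * (K * δ ^ 2) = K * δ / 2 := by
      field_simp
    nlinarith
  have heq : ∫ z, bracketLoss φ C₁ f₀ g w z ∂P =
      phiRisk φ P g - phiRisk φ P f₀ - C₁ * ∫ z, w z.1 ∂P := by
    have hgh : Integrable (fun z : 𝒳 × ℝ => φ (z.2 * g z.1) - φ (z.2 * f₀ z.1)) P := hg.sub h₀
    unfold bracketLoss
    rw [integral_sub hgh (hwi.const_mul _), integral_sub hg h₀, integral_const_mul]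
    rfl
  rw [heq]
  unfold excessPhiRisk
  have := mul_le_mul_of_nonneg_left hmean hC₁
  linarith

lemma integral_sq_bracketLoss_le [IsProbabilityMeasure P]
    (hφ : ∀ z₁ z₂ : ℝ, |φ z₁ - φ z₂| ≤ C₁ * |z₁ - z₂|) {fstar f₀ g w : 𝒳 → ℝ} {V W B : ℝ}
    (hmstar : Measurable fstar) (hm₀ : Measurable f₀) (hmg : Measurable g) (hw : Measurable w)
    (hw0 : ∀ x, 0 ≤ w x) (hwB : ∀ x, w x ≤ B) (hV : 0 ≤ V) (hW : 0 ≤ W)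
    (hg : ∫⁻ z, ENNReal.ofReal ((φ (z.2 * g z.1) - φ (z.2 * fstar z.1)) ^ 2) ∂P ≤
      ENNReal.ofReal V)
    (h₀ : ∫⁻ z, ENNReal.ofReal ((φ (z.2 * f₀ z.1) - φ (z.2 * fstar z.1)) ^ 2) ∂P ≤
      ENNReal.ofReal V)
    (hwW : ∫⁻ z, ENNReal.ofReal (w z.1 ^ 2) ∂P ≤ ENNReal.ofReal W) :
    ∫ z, bracketLoss φ C₁ f₀ g w z ^ 2 ∂P ≤ 3 * (2 * V + C₁ ^ 2 * min W (B ^ 2)) := by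
  have hlg := measurable_loss hφ hmg
  have hl₀ := measurable_loss hφ hm₀
  have hls := measurable_loss hφ hmstar
  obtain ⟨ig, hg'⟩ := integrable_and_integral_le_of_lintegral_le ((hlg.sub hls).pow_const 2)
    (fun z => sq_nonneg _) hV hg
  obtain ⟨i₀, h₀'⟩ := integrable_and_integral_le_of_lintegral_le ((hl₀.sub hls).pow_const 2)
    (fun z => sq_nonneg _) hV h₀
  obtain ⟨iw, hw'⟩ := integrable_and_integral_le_of_lintegral_le (P := P)
    (f := fun z : 𝒳 × ℝ => w z.1 ^ 2) (by fun_prop) (fun z => sq_nonneg _) hW hwW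
  have hwB' : ∫ z, w z.1 ^ 2 ∂P ≤ B ^ 2 := by
    calc ∫ z, w z.1 ^ 2 ∂P ≤ ∫ _, B ^ 2 ∂P :=
          integral_mono iw (integrable_const _) fun z => pow_le_pow_left₀ (hw0 _) (hwB _) 2
      _ = B ^ 2 := by simp
  simp only [Pi.sub_apply] at ig i₀ hg' h₀'
  have i1 := (ig.add i₀).add (iw.const_mul (C₁ ^ 2))
  have hle : ∫ z, bracketLoss φ C₁ f₀ g w z ^ 2 ∂P ≤
      ∫ z, 3 * ((φ (z.2 * g z.1) - φ (z.2 * fstar z.1)) ^ 2 +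
        (φ (z.2 * f₀ z.1) - φ (z.2 * fstar z.1)) ^ 2 + C₁ ^ 2 * w z.1 ^ 2) ∂P := by
    refine integral_mono_of_nonneg (ae_of_all _ fun z => sq_nonneg _) (i1.const_mul 3)
      (ae_of_all _ fun z => ?_)
    unfold bracketLoss
    simp only
    nlinarith [sq_nonneg ((φ (z.2 * g z.1) - φ (z.2 * fstar z.1)) +
        (φ (z.2 * f₀ z.1) - φ (z.2 * fstar z.1))),
      sq_nonneg ((φ (z.2 * g z.1) - φ (z.2 * fstar z.1)) + C₁ * w z.1),
      sq_nonneg ((φ (z.2 * f₀ z.1) - φ (z.2 * fstar z.1)) - C₁ * w z.1)]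
  refine hle.trans ?_
  have i2 : Integrable (fun z : 𝒳 × ℝ => (φ (z.2 * g z.1) - φ (z.2 * fstar z.1)) ^ 2 +
        (φ (z.2 * f₀ z.1) - φ (z.2 * fstar z.1)) ^ 2) P := ig.add i₀
  rw [integral_const_mul, integral_add i2 (iw.const_mul _), integral_add ig i₀,
    integral_const_mul]
  have := mul_le_mul_of_nonneg_left (le_min hw' hwB') (sq_nonneg C₁)
  linarith

end Loss

/-! ### The bound for a single bracket -/

lemma rpow_two_sub_mul_rpow {F e ν : ℝ} (hF : 0 < F) (he : 0 ≤ e) :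
    F ^ (2 - ν) * e ^ ν = F ^ 2 * (e / F) ^ ν := by
  rw [Real.rpow_sub hF, Real.div_rpow he hF.le]
  norm_cast
  ring

lemma min_sq_le_rpow {K δ F ν : ℝ} (hK : 0 ≤ K) (hδ : 0 < δ) (hF : 0 < F) (hν : 0 < ν)
    (hν1 : ν ≤ 1) : min (K * δ ^ 2) ((2 * F) ^ 2) ≤ (4 + K) * (F ^ (2 - ν) * δ ^ ν) := by
  rw [rpow_two_sub_mul_rpow hF hδ.le]
  have hr : 0 < δ / F := by positivity
  have hδF : δ ^ 2 = F ^ 2 * (δ / F) ^ 2 := by field_simp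
  rcases le_total (δ / F) 1 with h | h
  · have h1 : (δ / F) ^ 2 ≤ (δ / F) ^ ν := by
      have := Real.rpow_le_rpow_of_exponent_ge hr h (show ν ≤ 2 by linarith)
      exact_mod_cast this
    refine (min_le_left _ _).trans ?_
    rw [hδF]
    have : F ^ 2 * (δ / F) ^ 2 ≤ F ^ 2 * (δ / F) ^ ν := by gcongr
    have h2 : 0 ≤ F ^ 2 * (δ / F) ^ ν := by positivity
    nlinarith
  · have h1 : 1 ≤ (δ / F) ^ ν := Real.one_le_rpow h hν.le
    refine (min_le_right _ _).trans ?_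
    have : F ^ 2 * 1 ≤ F ^ 2 * (δ / F) ^ ν := by gcongr
    have h2 : 0 ≤ K * (F ^ 2 * (δ / F) ^ ν) := by positivity
    nlinarith

/-- If `h` has mean at least `e / 2`, size of order `F` and second moment of order
`F ^ (2 - ν) * e ^ ν`, its empirical sums are nonpositive only with exponentially small
probability. -/
lemma measureReal_sum_le_zero_le_of_moments {α Ω : Type*} [MeasurableSpace α]
    [MeasurableSpace Ω] {P : Measure α} [IsProbabilityMeasure P] {Q : Measure Ω}
    [IsProbabilityMeasure Q] {Z : ℕ → Ω → α} (hZ : ∀ i, Measurable (Z i)) (hind : iIndepFun Z Q)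
    (hlaw : ∀ i, Q.map (Z i) = P) {h : α → ℝ} (hh : Measurable h) {B c ν θ F e : ℝ}
    (hB : 0 < B) (hν1 : ν ≤ 1) (hθ : 0 < θ) (hcθ : c * θ ≤ 1 / 4)
    (hBθ : θ * B ^ (1 - ν) * B ≤ 1) (hF : 0 < F) (he : 0 < e) (heF : e ≤ B * F)
    (hM : ∀ᵐ z ∂P, |h z| ≤ B * F) (hmean : e / 2 ≤ ∫ z, h z ∂P)
    (hsq : ∫ z, h z ^ 2 ∂P ≤ c * (F ^ (2 - ν) * e ^ ν)) (n : ℕ) :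
    Q.real {ω | ∑ i ∈ Finset.range n, h (Z i ω) ≤ 0} ≤
      Real.exp (-(θ / 4 * n * (e / F) ^ (2 - ν))) := by
  set r := e / F with hr
  have hr0 : 0 < r := by positivity
  have hrB : r ≤ B := (div_le_iff₀ hF).2 heF
  -- this choice of `t` balances the two terms of the exponent
  have htM : θ * r ^ (1 - ν) / F * (B * F) ≤ 1 := by
    have h1 : r ^ (1 - ν) ≤ B ^ (1 - ν) := Real.rpow_le_rpow hr0.le hrB (by linarith)
    calc θ * r ^ (1 - ν) / F * (B * F) = θ * r ^ (1 - ν) * B := by field_simp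
      _ ≤ θ * B ^ (1 - ν) * B := by gcongr
      _ ≤ 1 := hBθ
  refine (measureReal_sum_le_zero_le hZ hind hlaw hh hM (by positivity) htM n).trans ?_
  rw [Real.exp_le_exp]
  have e1 : r ^ (1 - ν) * r = r ^ (2 - ν) := by
    rw [← Real.rpow_add_one hr0.ne']
    congr 1
    ring
  have e2 : r ^ (1 - ν) * r ^ ν = r := by
    rw [← Real.rpow_add hr0]
    simp
  have heq : e = r * F := by rw [hr]; field_simp
  have h1 : θ * r ^ (1 - ν) / F * (e / 2) = θ / 2 * r ^ (2 - ν) := by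
    rw [← e1, heq]
    field_simp
  have h2 : (θ * r ^ (1 - ν) / F) ^ 2 * (c * (F ^ (2 - ν) * e ^ ν)) =
      c * θ * (θ * r ^ (2 - ν)) := by
    rw [rpow_two_sub_mul_rpow hF he.le, ← hr]
    calc (θ * r ^ (1 - ν) / F) ^ 2 * (c * (F ^ 2 * r ^ ν))
        = c * θ * (θ * (r ^ (1 - ν) * (r ^ (1 - ν) * r ^ ν))) := by field_simp
      _ = _ := by rw [e2, e1]
  have h3 := mul_le_mul_of_nonneg_left hmean
    (show 0 ≤ θ * r ^ (1 - ν) / F by positivity)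
  have h4 := mul_le_mul_of_nonneg_left hsq (sq_nonneg (θ * r ^ (1 - ν) / F))
  have h5 : c * θ * (θ * r ^ (2 - ν)) ≤ 1 / 4 * (θ * r ^ (2 - ν)) := by gcongr
  have h6 : -(θ * r ^ (1 - ν) / F) * ∫ z, h z ∂P +
      (θ * r ^ (1 - ν) / F) ^ 2 * ∫ z, h z ^ 2 ∂P ≤ -(θ / 4 * r ^ (2 - ν)) := by
    rw [h1] at h3
    rw [h2] at h4
    linarith
  calc _ ≤ (n : ℝ) * -(θ / 4 * r ^ (2 - ν)) := mul_le_mul_of_nonneg_left h6 (Nat.cast_nonneg n)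
    _ = _ := by ring

/-- The functions of large excess risk in one bracket: outside a single event of small
probability, none of them has an empirical risk as low as that of `f₀`. -/
lemma exists_event_of_bracket {𝒳 Ω : Type*} [MeasurableSpace 𝒳] [MeasurableSpace Ω]
    {P : Measure (𝒳 × ℝ)} [IsProbabilityMeasure P] (hlab : ∀ᵐ z ∂P, z.2 = 1 ∨ z.2 = -1)
    {μ : Measure 𝒳} {C₁ C₂ ν K θ F a δ b : ℝ} (hdom : P.map Prod.fst ≤ ENNReal.ofReal K • μ)
    {Q : Measure Ω} [IsProbabilityMeasure Q] {Z : ℕ → Ω → 𝒳 × ℝ} (hZ : ∀ i, Measurable (Z i))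
    (hind : iIndepFun Z Q) (hlaw : ∀ i, Q.map (Z i) = P) {φ : ℝ → ℝ} {G 𝓕 : Set (𝒳 → ℝ)}
    (hG : ∀ f ∈ G, Measurable f) {fstar : 𝒳 → ℝ} (hstar : IsPhiRiskMinimizer φ P G fstar)
    (h𝓕 : 𝓕 ⊆ G) (hφ : ∀ z₁ z₂ : ℝ, |φ z₁ - φ z₂| ≤ C₁ * |z₁ - z₂|)
    (hC₁ : 0 < C₁) (hC₂ : 0 < C₂) (hν : 0 < ν) (hν1 : ν ≤ 1) (hK : 0 < K) (hF : 0 < F)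
    (hδ : 0 < δ) (hb : 0 < b) (hbound : ∀ f ∈ 𝓕, ∀ x, |f x| ≤ F)
    (hvar : ∀ f ∈ 𝓕, ∫⁻ z, ENNReal.ofReal ((φ (z.2 * f z.1) - φ (z.2 * fstar z.1)) ^ 2) ∂P ≤
      ENNReal.ofReal (C₂ * F ^ (2 - ν) * excessPhiRisk φ P f fstar ^ ν))
    (hθ : 0 < θ) (hcθ : 3 * (2 * C₂ + C₁ ^ 2 * (4 + K)) * θ ≤ 1 / 4)
    (hBθ : θ * (8 * C₁) ^ (1 - ν) * (8 * C₁) ≤ 1)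
    (hab : 4 * a ≤ b) (hδb : δ ≤ b) (hKb : 4 * (C₁ * (K + 1)) * δ ≤ b)
    {f₀ : 𝒳 → ℝ} (hf₀ : f₀ ∈ 𝓕) (hf₀a : excessPhiRisk φ P f₀ fstar ≤ a)
    {l u : 𝒳 → ℝ} (hl : Measurable l) (hu : Measurable u)
    (hlu : eLpNorm (fun x => u x - l x) 2 μ ≤ ENNReal.ofReal δ) {n : ℕ} (hn : 1 ≤ n) :
    ∃ A : Set Ω, Q.real A ≤ Real.exp (-(θ / 4 * n * (b / F) ^ (2 - ν))) ∧
      ∀ᵐ ω ∂Q, ∀ f ∈ 𝓕, b ≤ excessPhiRisk φ P f fstar → (∀ x, l x ≤ f x ∧ f x ≤ u x) →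
        empiricalPhiRisk φ n (fun i => Z i ω) f ≤ empiricalPhiRisk φ n (fun i => Z i ω) f₀ →
          ω ∈ A := by
  by_cases hS : ∃ g ∈ 𝓕, b ≤ excessPhiRisk φ P g fstar ∧ ∀ x, l x ≤ g x ∧ g x ≤ u x
  swap
  · refine ⟨∅, by simpa using (Real.exp_pos _).le, ae_of_all _ fun ω f hf hbf hlf _ => ?_⟩
    exact absurd ⟨f, hf, hbf, hlf⟩ hS
  obtain ⟨g, hg, hbg, hlg⟩ := hS
  -- the width is truncated because Bernstein's bound needs `w` of order `F`
  set w : 𝒳 → ℝ := fun x => min (u x - l x) (2 * F) with hw_def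
  set e := excessPhiRisk φ P g fstar with he_def
  have he : 0 < e := hb.trans_le hbg
  have hul0 : ∀ x, 0 ≤ u x - l x := fun x => sub_nonneg.2 ((hlg x).1.trans (hlg x).2)
  have hw0 : ∀ x, 0 ≤ w x := fun x => le_min (hul0 x) (by positivity)
  have hwF : ∀ x, w x ≤ 2 * F := fun x => min_le_right _ _
  have hwm : Measurable w := (hu.sub hl).min measurable_const
  have hgm := hG g (h𝓕 hg)
  have hf₀m := hG f₀ (h𝓕 hf₀)
  have hwδ : ∫⁻ z, ENNReal.ofReal (w z.1 ^ 2) ∂P ≤ ENNReal.ofReal (K * δ ^ 2) := by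
    refine le_trans (lintegral_mono fun z => ENNReal.ofReal_le_ofReal ?_)
      (lintegral_sq_bracket_le hK hδ.le hdom (hu.sub hl) hlu)
    exact pow_le_pow_left₀ (hw0 _) (min_le_left _ _) 2
  have hhm := measurable_bracketLoss hφ hf₀m hgm hwm
  have hM : ∀ᵐ z ∂P, |bracketLoss φ C₁ f₀ g w z| ≤ 4 * C₁ * F := by
    filter_upwards [hlab] with z hz
    exact abs_bracketLoss_le hφ hC₁.le (hbound f₀ hf₀) (hbound g hg) hw0 hwF hz
  have hmean : e / 2 ≤ ∫ z, bracketLoss φ C₁ f₀ g w z ∂P := by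
    have h := le_integral_bracketLoss (fstar := fstar) (B := 2 * F) hC₁.le hK.le hδ
      (integrable_loss hlab hC₁.le hφ hgm (hbound g hg))
      (integrable_loss hlab hC₁.le hφ hf₀m (hbound f₀ hf₀)) hwm hw0 hwF hwδ
    linarith
  -- `fstar` may be unbounded, but the mean of the bracket loss is not
  have heF : e ≤ 8 * C₁ * F := by
    have h := norm_integral_le_of_norm_le_const (μ := P) (f := bracketLoss φ C₁ f₀ g w) hM
    rw [probReal_univ, mul_one] at h
    have := (le_abs_self _).trans h
    linarith
  have hsq : ∫ z, bracketLoss φ C₁ f₀ g w z ^ 2 ∂P ≤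
      3 * (2 * C₂ + C₁ ^ 2 * (4 + K)) * (F ^ (2 - ν) * e ^ ν) := by
    have h0 := excessPhiRisk_nonneg hlab hC₁.le hφ hstar (h𝓕 hf₀) hf₀m (hbound f₀ hf₀)
    have hV₀ : C₂ * F ^ (2 - ν) * excessPhiRisk φ P f₀ fstar ^ ν ≤
        C₂ * F ^ (2 - ν) * e ^ ν := by
      gcongr
      linarith
    have h := integral_sq_bracketLoss_le hφ (hG fstar hstar.mem) hf₀m hgm hwm hw0 hwF
      (by positivity) (by positivity) (hvar g hg)
      ((hvar f₀ hf₀).trans (ENNReal.ofReal_le_ofReal hV₀)) hwδ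
    have h1 : min (K * δ ^ 2) ((2 * F) ^ 2) ≤ (4 + K) * (F ^ (2 - ν) * e ^ ν) := by
      refine (min_sq_le_rpow hK.le hδ hF hν hν1).trans ?_
      gcongr
      linarith
    have h2 := mul_le_mul_of_nonneg_left h1 (sq_nonneg C₁)
    rw [← he_def] at h
    linarith
  refine ⟨{ω | ∑ i ∈ Finset.range n, bracketLoss φ C₁ f₀ g w (Z i ω) ≤ 0}, ?_, ?_⟩
  · refine (measureReal_sum_le_zero_le_of_moments hZ hind hlaw hhm (by positivity) hν1 hθ hcθ
      hBθ hF he heF (hM.mono fun z hz => hz.trans ?_) hmean hsq n).trans ?_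
    · nlinarith [mul_pos hC₁ hF]
    -- `g` has excess risk at least `b`, so its exponent is at least the one claimed
    · gcongr
      linarith
  · have hlabZ : ∀ᵐ ω ∂Q, ∀ i, (Z i ω).2 = 1 ∨ (Z i ω).2 = -1 := by
      rw [ae_all_iff]
      intro i
      rw [← hlaw i] at hlab
      exact ae_of_ae_map (hZ i).aemeasurable hlab
    filter_upwards [hlabZ] with ω hω f hf _ hlf hemp
    exact sum_bracketLoss_nonpos hφ hC₁.le
      (fun x => abs_sub_le_min_width (hbound f hf x) (hbound g hg x) (hlf x) (hlg x)) hn hω hemp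

/-! ### The union bound over the brackets -/

theorem mainTheorem5 (C₁ C₂ C₃ ν K : ℝ) (hC₁ : 0 < C₁) (hC₂ : 0 < C₂) (hC₃ : 0 < C₃)
    (hν : 0 < ν) (hν1 : ν ≤ 1) (hK : 0 < K) :
    -- the constants depend on nothing but `C₁, C₂, C₃, ν, K`
    ∃ c₀ : ℝ, 0 < c₀ ∧ ∃ C : ℝ, 0 < C ∧ ∃ C' : ℝ, 0 < C' ∧
      ∀ (𝒳 : Type*) [MeasurableSpace 𝒳] (Ω : Type*) [MeasurableSpace Ω]
        -- the law of `(X, Y)`, with labels in `{-1, 1}`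
        (P : Measure (𝒳 × ℝ)) [IsProbabilityMeasure P]
        (_ : ∀ᵐ z ∂P, z.2 = 1 ∨ z.2 = -1)
        -- the measure that defines `‖·‖₂` dominates the law of `X`
        (μ : Measure 𝒳) (_ : P.map Prod.fst ≤ ENNReal.ofReal K • μ)
        -- i.i.d. data with law `P`
        (Q : Measure Ω) [IsProbabilityMeasure Q] (Z : ℕ → Ω → 𝒳 × ℝ)
        (_ : ∀ i, Measurable (Z i)) (_ : iIndepFun Z Q) (_ : ∀ i, Q.map (Z i) = P)
        -- the loss, the limit class and the population minimizer over it
        (φ : ℝ → ℝ) (Flim : Set (𝒳 → ℝ)) (_ : ∀ f ∈ Flim, Measurable f)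
        (fstar : 𝒳 → ℝ) (_ : IsPhiRiskMinimizer φ P Flim fstar)
        (𝓕 : ℕ → Set (𝒳 → ℝ)) (_ : ∀ n, 1 ≤ n → 𝓕 n ⊆ Flim)
        (a F δ : ℕ → ℝ)
        -- (A1)
        (_ : ∀ z₁ z₂ : ℝ, |φ z₁ - φ z₂| ≤ C₁ * |z₁ - z₂|)
        -- (A2)
        (_ : ∀ n, 1 ≤ n → 0 < a n)
        (_ : ∃ a₀ : ℝ, 0 < a₀ ∧ a =O[atTop] fun n : ℕ => (n : ℝ) ^ (-a₀))
        (_ : ∀ n, 1 ≤ n → ∃ f ∈ 𝓕 n, excessPhiRisk φ P f fstar ≤ a n)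
        -- (A3)
        (_ : ∃ c : ℝ, 0 < c ∧ ∀ᶠ n in atTop, c ≤ F n)
        (_ : ∀ n, 1 ≤ n → ∀ f ∈ 𝓕 n, ∀ x, |f x| ≤ F n)
        -- (A4)
        (_ : ∀ n, 1 ≤ n → ∀ f ∈ 𝓕 n,
          ∫⁻ z, ENNReal.ofReal ((φ (z.2 * f z.1) - φ (z.2 * fstar z.1)) ^ 2) ∂P ≤
            ENNReal.ofReal (C₂ * F n ^ (2 - ν) * excessPhiRisk φ P f fstar ^ ν))
        -- (A5)
        (_ : ∀ n, 1 ≤ n → 0 < δ n)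
        (_ : ∀ n, 1 ≤ n →
          bracketingEntropy μ (δ n) (𝓕 n) ≤ ((C₃ * n * (δ n / F n) ^ (2 - ν) : ℝ) : EReal))
        -- the empirical `φ`-risk minimizer
        (fhat : ℕ → Ω → 𝒳 → ℝ)
        (_ : ∀ n, 1 ≤ n → ∀ᵐ ω ∂Q,
          IsEmpiricalPhiRiskMinimizer φ n (fun i => Z i ω) (𝓕 n) (fhat n ω))
        -- the rate: any sequence that is eventually at least `c₀ max {aₙ, δₙ}`
        (ε : ℕ → ℝ) (_ : ∀ᶠ n in atTop, c₀ * max (a n) (δ n) ≤ ε n ^ 2),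
        ∀ᶠ n : ℕ in atTop,
          Q.real {ω | ε n ^ 2 ≤ excessPhiRisk φ P (fhat n ω) fstar} ≤
            C' * Real.exp (-(C * n * (ε n ^ 2 / F n) ^ (2 - ν))) := by
  set c := 3 * (2 * C₂ + C₁ ^ 2 * (4 + K)) with hc_def
  have hc : 0 < c := by positivity
  set D := (8 * C₁) ^ (1 - ν) * (8 * C₁) with hD_def
  have hD : 0 < D := by positivity
  set θ := min (1 / (4 * c)) (1 / D) with hθ_def
  have hθ : 0 < θ := lt_min (by positivity) (by positivity)
  have hcθ : c * θ ≤ 1 / 4 := by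
    calc c * θ ≤ c * (1 / (4 * c)) := by gcongr; exact min_le_left _ _
      _ = 1 / 4 := by field_simp
  have hBθ : θ * (8 * C₁) ^ (1 - ν) * (8 * C₁) ≤ 1 := by
    rw [mul_assoc, ← hD_def]
    calc θ * D ≤ 1 / D * D := by gcongr; exact min_le_right _ _
      _ = 1 := by field_simp
  -- the three terms control the bias `a n`, the bracket width and the bracketing number
  set c₀ := max 4 (max (4 * (C₁ * (K + 1))) (8 * C₃ / θ)) with hc₀_def
  have hc₀4 : 4 ≤ c₀ := le_max_left _ _
  have hc₀K : 4 * (C₁ * (K + 1)) ≤ c₀ := (le_max_left _ _).trans (le_max_right _ _)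
  have hc₀θ : 8 * C₃ / θ ≤ c₀ := (le_max_right _ _).trans (le_max_right _ _)
  have hc₀ : 0 < c₀ := by linarith
  refine ⟨c₀, hc₀, θ / 8, by positivity, 1, one_pos, ?_⟩
  intro 𝒳 _ Ω _ P _ hlab μ hdom Q _ Z hZ hind hlaw φ G hG fstar hstar 𝓕 h𝓕 a F δ hφ ha _ happ
    hFpos hbound hvar hδ hent fhat hfhat ε hε
  obtain ⟨cF, hcF, hcFev⟩ := hFpos
  filter_upwards [hcFev, hε, eventually_ge_atTop 1] with n hFn hεn hn
  have hF : 0 < F n := hcF.trans_le hFn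
  have ha' := ha n hn
  have hδ' := hδ n hn
  set b := ε n ^ 2 with hb_def
  have hab : c₀ * a n ≤ b := (mul_le_mul_of_nonneg_left (le_max_left _ _) hc₀.le).trans hεn
  have hδb : c₀ * δ n ≤ b := (mul_le_mul_of_nonneg_left (le_max_right _ _) hc₀.le).trans hεn
  have hb : 0 < b := (mul_pos hc₀ ha').trans_le hab
  obtain ⟨f₀, hf₀, hf₀a⟩ := happ n hn
  obtain ⟨N, ⟨l, u, hlum, hlu, hcov⟩, hN⟩ := exists_hasBracketing_card_le (hent n hn)
  have hev := fun i => exists_event_of_bracket hlab hdom hZ hind hlaw hG hstar (h𝓕 n hn) hφ hC₁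
    hC₂ hν hν1 hK hF hδ' hb (hbound n hn) (hvar n hn) hθ hcθ hBθ
    ((mul_le_mul_of_nonneg_right hc₀4 ha'.le).trans hab) (by nlinarith)
    ((mul_le_mul_of_nonneg_right hc₀K hδ'.le).trans hδb) hf₀ hf₀a (hlum i).1 (hlum i).2 (hlu i)
    hn
  choose A hA hAev using hev
  have hsub : {ω | b ≤ excessPhiRisk φ P (fhat n ω) fstar} ≤ᵐ[Q] ⋃ i, A i := by
    filter_upwards [hfhat n hn, ae_all_iff.2 hAev] with ω hω hAω hbω
    obtain ⟨i, hi⟩ := hcov _ hω.1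
    exact Set.mem_iUnion.2 ⟨i, hAω i _ hω.1 hbω hi (hω.2 f₀ hf₀)⟩
  set ρ := (b / F n) ^ (2 - ν) with hρ_def
  have hρ : 0 ≤ ρ := by positivity
  have hentropy : C₃ * n * (δ n / F n) ^ (2 - ν) ≤ θ / 8 * n * ρ := by
    have h1 : δ n / F n ≤ c₀⁻¹ * (b / F n) := by
      rw [← mul_div_assoc, div_le_div_iff_of_pos_right hF, inv_mul_eq_div, le_div_iff₀ hc₀]
      linarith
    have h2 : (δ n / F n) ^ (2 - ν) ≤ c₀⁻¹ * ρ := by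
      refine (Real.rpow_le_rpow (by positivity) h1 (by linarith)).trans ?_
      rw [Real.mul_rpow (by positivity) (by positivity)]
      gcongr
      have h3 : c₀⁻¹ ^ (2 - ν) ≤ c₀⁻¹ ^ (1 : ℝ) :=
        Real.rpow_le_rpow_of_exponent_ge (by positivity) (inv_le_one_of_one_le₀ (by linarith))
          (by linarith)
      simpa using h3
    have h4 : C₃ * c₀⁻¹ ≤ θ / 8 := by
      rw [← div_eq_mul_inv, div_le_iff₀ hc₀]
      rw [div_le_iff₀ hθ] at hc₀θ
      linarith
    calc C₃ * n * (δ n / F n) ^ (2 - ν) ≤ C₃ * n * (c₀⁻¹ * ρ) := by gcongr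
      _ = C₃ * c₀⁻¹ * n * ρ := by ring
      _ ≤ θ / 8 * n * ρ := by gcongr
  calc Q.real {ω | b ≤ excessPhiRisk φ P (fhat n ω) fstar}
      ≤ Q.real (⋃ i, A i) := ENNReal.toReal_mono (measure_ne_top _ _) (measure_mono_ae hsub)
    _ ≤ ∑ i, Q.real (A i) := measureReal_iUnion_fintype_le _
    _ ≤ ∑ _i : Fin N, Real.exp (-(θ / 4 * n * ρ)) := Finset.sum_le_sum fun i _ => hA i
    _ = N * Real.exp (-(θ / 4 * n * ρ)) := by simp
    _ ≤ Real.exp (θ / 8 * n * ρ) * Real.exp (-(θ / 4 * n * ρ)) := by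
        gcongr
        exact hN.trans (Real.exp_le_exp.2 hentropy)
    _ = 1 * Real.exp (-(θ / 8 * n * ρ)) := by
        rw [← Real.exp_add, one_mul]
        congr 1
        ring
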